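/- Conventions. All Hilbert spaces are complex; $\boldsymbol B(\mathcal H,\mathcal K)$ denotes the bounded linear operators $\mathcal H\to\mathcal K$ and $\boldsymbol B(\mathcal H)=\boldsymbol B(\mathcal H,\mathcal H)$. A representation of a unital $C^*$-algebra $\mathscr A$ is a unital $*$-homomorphism $\mathscr A\to\boldsymbol B(\mathcal H)$, and a character is a unital $*$-homomorphism $\chi\colon\mathscr A\to\mathbb C$. A set $G\subseteq\mathscr A$ is hyperrigid if it is finite or countably infinite, generates $\mathscr A$ as a unital $C^*$-algebra, and for every faithful representation $\pi\colon\mathscr A\to\boldsymbol B(\mathcal H)$ on a separable Hilbert space $\mathcal H$ and every sequence $\varPhi_k\colon\boldsymbol B(\mathcal H)\to\boldsymbol B(\mathcal H)$ $(k\in\mathbb N)$ of unital completely positive maps, $$\lim_{k\to\infty}\|\varPhi_k(\pi(g))-\pi(g)\|=0\ \ \forall g\in G\ \implies\ \lim_{k\to\infty}\|\varPhi_k(\pi(a))-\pi(a)\|=0\ \ \forall a\in\mathscr A.$$ For a contraction $R\in\boldsymbol B(\mathcal H,\mathcal K)$ put $\triangle_R=I-R^*R$ and $\triangle_{R^*}=I-RR^*$.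 An operator $T$ is a pure contraction if $\|Th\|<\|h\|$ for every $h\neq0$. A closed subspace reduces a representation if it is invariant under all operators of the representation and their adjoints. Given a character $\chi$, representations $\pi\colon\mathscr A\to\boldsymbol B(\mathcal H)$, $\rho\colon\mathscr A\to\boldsymbol B(\mathcal K)$, a contraction $R\in\boldsymbol B(\mathcal H,\mathcal K)$, and closed subspaces $\mathcal H_0,\mathcal H_1\subseteq\mathcal H$ and $\mathcal K_0,\mathcal K_1\subseteq\mathcal K$, the triple $(\pi,\rho,R)$ has an isometric $\chi$-decomposition relative to $(\mathcal H_0,\mathcal H_1,\mathcal K_0,\mathcal K_1)$ if (1) $\mathcal H=\mathcal H_0\oplus\mathcal H_1$ and $\mathcal K=\mathcal K_0\oplus\mathcal K_1$ (orthogonal sums); (2) $\mathcal H_0,\mathcal H_1$ reduce $\pi$ and $\mathcal K_0,\mathcal K_1$ reduce $\rho$; (3) $\pi(a)|_{\mathcal H_1}=\chi(a)I_{\mathcal H_1}$ and $\rho(a)|_{\mathcal K_1}=\chi(a)I_{\mathcal K_1}$ for all $a\in\mathscr A$; (4) $R=R_0\oplus R_1$, where $R_0\in\boldsymbol B(\mathcal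 H_0,\mathcal K_0)$ is isometric and $R_1\in\boldsymbol B(\mathcal H_1,\mathcal K_1)$; (5) $\pi(a)|_{\mathcal H_0}=R_0^*\,\rho(a)|_{\mathcal K_0}\,R_0$ for all $a\in\mathscr A$. **Theorem.** Let $G$ be a hyperrigid subset of a unital $C^*$-algebra $\mathscr A$ and let $\chi$ be a character of $\mathscr A$ such that $G\subseteq\ker\chi$. Suppose that $\mathcal H$ and $\mathcal K$ are separable Hilbert spaces, $\pi\colon\mathscr A\to\boldsymbol B(\mathcal H)$ and $\rho\colon\mathscr A\to\boldsymbol B(\mathcal K)$ are representations, and $R\in\boldsymbol B(\mathcal H,\mathcal K)$ is a non-isometric contraction such that $\pi(g)=R^*\rho(g)R$ for all $g\in G$. Then (i) $\triangle_R$ commutes with $\pi(a)$ and $\triangle_{R^*}$ commutes with $\rho(a)$ for every $a\in\mathscr A$; (ii) $(\pi,\rho,R)$ has an isometric $\chi$-decomposition relative to $(\mathcal H_0,\mathcal H_1,\mathcal K_0,\mathcal K_1)$, where $\mathcal H_1=\overline{\operatorname{ran}(\triangle_R)}$, $\mathcal H_0=\mathcal H_1^\perp$, $\mathcal K_1=\overline{\operatorname{ran}(\triangle_{R^*}R)}$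 and $\mathcal K_0=\mathcal K_1^\perp$; (iii) the operator $R_1\in\boldsymbol B(\mathcal H_1,\mathcal K_1)$ in this decomposition is a pure contraction with dense range. -/

import Mathlib

open scoped CStarAlgebra

noncomputable section

/-- `G` is a hyperrigid subset of the unital C⋆-algebra `A`: it is a finite or countably infinite
set of generators of `A` (as a unital C⋆-algebra) such that for every faithful representation `π`
of `A` on a separable complex Hilbert space `H` and every sequence `Φ k` of unital completely
positive maps of `B(H)` into itself, norm convergence `Φ k (π g) → π g` for all `g ∈ G` implies
norm convergence `Φ k (π a) → π a` for all `a ∈ A`.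

Every separable Hilbert space is unitarily equivalent to one in the lowest universe (`ℂ ^ n` or
`ℓ²`), so letting `H` range over `Type` is no restriction. -/
structure IsHyperrigid {A : Type*} [CStarAlgebra A] (G : Set A) : Prop where
  countable : G.Countable
  generates : (StarAlgebra.adjoin ℂ G).topologicalClosure = ⊤
  rigid : ∀ (H : Type) [NormedAddCommGroup H] [InnerProductSpace ℂ H] [CompleteSpace H]
    [TopologicalSpace.SeparableSpace H] (π : A →⋆ₐ[ℂ] (H →L[ℂ] H)),
    Function.Injective π →
    ∀ Φ : ℕ → ((H →L[ℂ] H) →CP (H →L[ℂ] H)), (∀ k, Φ k 1 = 1) →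
      (∀ g ∈ G, Filter.Tendsto (fun k => ‖Φ k (π g) - π g‖) Filter.atTop (nhds 0)) →
      ∀ a : A, Filter.Tendsto (fun k => ‖Φ k (π a) - π a‖) Filter.atTop (nhds 0)

section Operators

variable {H K : Type*} [NormedAddCommGroup H] [InnerProductSpace ℂ H]
  [NormedAddCommGroup K] [InnerProductSpace ℂ K]

/-- `triangleOp R = I - R⋆ R`, the square of the defect operator of the contraction `R`.
In particular `triangleOp R⋆ = I - R R⋆`. -/
def triangleOp [CompleteSpace H] [CompleteSpace K] (R : H →L[ℂ] K) : H →L[ℂ] H :=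
  1 - (ContinuousLinearMap.adjoint R) ∘L R

/-- `R` is a pure contraction: `‖R h‖ < ‖h‖` for every nonzero `h`. -/
def IsPureContraction (R : H →L[ℂ] K) : Prop :=
  ∀ h : H, h ≠ 0 → ‖R h‖ < ‖h‖

/-- The subspace `M` reduces the operator `T`: it is invariant under both `T` and `T⋆`. -/
def Reduces [CompleteSpace H] (M : Submodule ℂ H) (T : H →L[ℂ] H) : Prop :=
  (∀ x ∈ M, T x ∈ M) ∧ ∀ x ∈ M, ContinuousLinearMap.adjoint T x ∈ M

end Operators

/-- `(π, ρ, R)` has an isometric `χ`-decomposition relative to `(H₀, H₁, K₀, K₁)`, with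
`R = R₀ ⊕ R₁`. The subspaces are closed, which is expressed by their completeness; the operators
`R₀` and `R₁` are determined by `R` and the subspaces. -/
structure IsIsometricDecomposition {A H K : Type*} [CStarAlgebra A]
    [NormedAddCommGroup H] [InnerProductSpace ℂ H] [CompleteSpace H]
    [NormedAddCommGroup K] [InnerProductSpace ℂ K] [CompleteSpace K]
    (χ : A →⋆ₐ[ℂ] ℂ) (π : A →⋆ₐ[ℂ] (H →L[ℂ] H)) (ρ : A →⋆ₐ[ℂ] (K →L[ℂ] K)) (R : H →L[ℂ] K)
    (H₀ H₁ : Submodule ℂ H) (K₀ K₁ : Submodule ℂ K)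
    [CompleteSpace H₀] [CompleteSpace H₁] [CompleteSpace K₀] [CompleteSpace K₁]
    (R₀ : H₀ →L[ℂ] K₀) (R₁ : H₁ →L[ℂ] K₁) : Prop where
  orthogonal_left : H₀ ⟂ H₁
  isCompl_left : IsCompl H₀ H₁
  orthogonal_right : K₀ ⟂ K₁
  isCompl_right : IsCompl K₀ K₁
  reduces_H₀ : ∀ a, Reduces H₀ (π a)
  reduces_H₁ : ∀ a, Reduces H₁ (π a)
  reduces_K₀ : ∀ a, Reduces K₀ (ρ a)
  reduces_K₁ : ∀ a, Reduces K₁ (ρ a)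
  left_eq_char : ∀ a, (π a).restrict (reduces_H₁ a).1 = χ a • (1 : H₁ →L[ℂ] H₁)
  right_eq_char : ∀ a, (ρ a).restrict (reduces_K₁ a).1 = χ a • (1 : K₁ →L[ℂ] K₁)
  apply_H₀ : ∀ h : H₀, R h = R₀ h
  apply_H₁ : ∀ h : H₁, R h = R₁ h
  isometry : Isometry R₀
  compression : ∀ a, (π a).restrict (reduces_H₀ a).1 =
    (ContinuousLinearMap.adjoint R₀) ∘L (ρ a).restrict (reduces_K₀ a).1 ∘L R₀

end

/-! Choose `D` with D⋆D = I - R⋆R. Then V = (R, D) : H → K ⊕ H is an isometry, and since χ vanishes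
on `G`, π agrees on `G` with the compression by V of θ = ρ ⊕ χ·I. Hyperrigidity extends this
agreement to all of `A` (`IsHyperrigid.eq_compression`). A compression by an isometry that is itself
multiplicative forces Vπ(a) = θ(a)V (`intertwines_of_eq_compression`). Reading the two coordinates
gives Rπ(a) = ρ(a)R and Δπ(a) = χ(a)Δ for Δ = I - R⋆R (`IsHyperrigid.intertwines`); the theorem then
follows by taking adjoints and closures.

The definition of hyperrigidity speaks of maps on B(L) for a faithful separable representation on L.
So `eq_compression` works on L = H ⊕ K ⊕ S with π ⊕ θ ⊕ σ, where σ is faithful on a separable S, and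
applies a constant sequence of unital maps with two Kraus operators. Such a σ exists because `A` is
countably generated, hence separable, hence has a faithful positive functional, to which GNS
applies. -/

theorem Complex.eq_one_and_eq_of_add_eq {z w : ℂ} {r : ℝ} (hz : ‖z‖ ≤ 1) (hw : ‖w‖ ≤ r)
    (h : z + w = 1 + r) : z = 1 ∧ w = r := by
  have h1 := Complex.re_le_norm z
  have h2 := Complex.re_le_norm w
  have h3 : z.re + w.re = 1 + r := by simpa using congrArg Complex.re h
  have hz' : z.re = 1 := by linarith
  have hz1 : z = 1 := by
    have h4 := Complex.sq_norm_sub_sq_re z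
    have h5 : z.im ^ 2 = 0 := by
      have : ‖z‖ ^ 2 ≤ 1 := pow_le_one₀ (norm_nonneg z) hz
      rw [hz'] at h4
      nlinarith [sq_nonneg z.im]
    exact Complex.ext (by simpa using hz') (by simpa using h5)
  refine ⟨hz1, ?_⟩
  rw [hz1] at h
  exact add_left_cancel h

/-! ### States and a faithful positive functional. -/

section States

variable {A : Type*} [CStarAlgebra A] [PartialOrder A] [StarOrderedRing A]

open scoped ComplexOrder

/-- The norm of a positive element lies in its spectrum, and adding 1 shifts the spectrum. -/
theorem norm_one_add_of_nonneg [Nontrivial A] {b : A} (hb : 0 ≤ b) : ‖1 + b‖ = 1 + ‖b‖ := by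
  refine le_antisymm ((norm_add_le _ _).trans (by simp)) ?_
  have h : 1 + ‖b‖ ∈ spectrum ℝ (algebraMap ℝ A 1 + b) := by
    rw [← spectrum.singleton_add_eq]
    exact Set.add_mem_add rfl (CStarAlgebra.norm_mem_spectrum_of_nonneg hb)
  rw [map_one] at h
  have := spectrum.norm_le_norm_of_mem h
  rw [Real.norm_of_nonneg (by positivity)] at this
  exact this

/-- A functional of norm at most one which is unital is positive. -/
theorem nonneg_of_norm_le_one_of_map_one {f : A →L[ℂ] ℂ} (hf : ‖f‖ ≤ 1) (h1 : f 1 = 1)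
    {c : A} (hc : 0 ≤ c) : 0 ≤ f c := by
  have hle : ∀ x, ‖f x‖ ≤ ‖x‖ := fun x => (f.le_opNorm x).trans <|
    mul_le_of_le_one_left (norm_nonneg x) hf
  have hA : Nontrivial A := ⟨1, 0, fun h => by simp [h] at h1⟩
  have hsa : star c = c := (IsSelfAdjoint.of_nonneg hc).star_eq
  have him : (f c).im = 0 := by
    -- Comparing |f(c + it)|² with ‖c + it‖² ≤ ‖c‖² + t² cancels t²; what remains is affine in t and
    -- bounded above, so its slope must vanish.
    have key : ∀ t : ℝ, (f c).im ^ 2 + 2 * (f c).im * t ≤ ‖c‖ ^ 2 := by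
      intro t
      have e1 : ‖c + (Complex.I * t) • (1 : A)‖ ^ 2 ≤ ‖c‖ ^ 2 + t ^ 2 := by
        rw [sq, ← CStarRing.norm_star_mul_self]
        have : star (c + (Complex.I * t) • (1 : A)) * (c + (Complex.I * t) • (1 : A))
            = c * c + ((t ^ 2 : ℝ) : ℂ) • (1 : A) := by
          simp only [star_add, star_smul, star_one, hsa, add_mul, mul_add, smul_mul_assoc, one_mul,
            mul_smul_comm, mul_one]
          have h1 : star (Complex.I * t) = - (Complex.I * t) := by simp
          have h2 : -(Complex.I * (t : ℂ)) * (Complex.I * t) = ((t ^ 2 : ℝ) : ℂ) := by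
            linear_combination (-(t : ℂ) ^ 2) * Complex.I_mul_I + (by push_cast; ring :
              (t : ℂ) ^ 2 = ((t ^ 2 : ℝ) : ℂ))
          rw [h1, smul_add, smul_smul, mul_comm _ (-_), h2, neg_smul]
          abel
        rw [this]
        refine (norm_add_le _ _).trans (add_le_add ?_ ?_)
        · exact (norm_mul_le _ _).trans (sq _).ge
        · rw [norm_smul, norm_one, mul_one, Complex.norm_real, Real.norm_of_nonneg (sq_nonneg t)]
      have e2 := hle (c + (Complex.I * t) • (1 : A))
      rw [map_add, map_smul, h1] at e2
      have e3 : (f c).re ^ 2 + ((f c).im + t) ^ 2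
          = ‖f c + (Complex.I * t) • (1 : ℂ)‖ ^ 2 := by
        rw [← Complex.normSq_eq_norm_sq, Complex.normSq_apply]
        simp
        ring
      have e4 : ‖f c + (Complex.I * t) • (1 : ℂ)‖ ^ 2 ≤ ‖c + (Complex.I * t) • (1 : A)‖ ^ 2 := by
        gcongr
      nlinarith [sq_nonneg (f c).re]
    by_contra hne
    have := key (‖c‖ ^ 2 / (2 * (f c).im))
    rw [mul_div_cancel₀ _ (by simpa using hne)] at this
    have := sq_nonneg (f c).im
    have : (f c).im ^ 2 = 0 := by linarith
    exact hne (by simpa using this)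
  have hre : 0 ≤ (f c).re := by
    -- Since 0 ≤ ‖c‖ - c ≤ ‖c‖, applying `f` yields ‖c‖ - Re f(c) ≤ ‖c‖.
    have e1 : ‖(‖c‖ : ℂ) • (1 : A) - c‖ ≤ ‖c‖ := by
      have e0 : (‖c‖ : ℂ) • (1 : A) = algebraMap ℝ A ‖c‖ := by
        rw [Algebra.algebraMap_eq_smul_one, Complex.coe_smul]
      have e2 : c ≤ algebraMap ℝ A ‖c‖ := IsSelfAdjoint.le_algebraMap_norm_self (.of_nonneg hc)
      rw [e0]
      calc _ ≤ ‖algebraMap ℝ A ‖c‖‖ :=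
            CStarAlgebra.norm_le_norm_of_nonneg_of_le (sub_nonneg.2 e2) (sub_le_self _ hc)
        _ = ‖c‖ := by simp
    have e2 := (hle _).trans e1
    rw [map_sub, map_smul, h1] at e2
    have e3 := (Complex.re_le_norm _).trans e2
    simp at e3
    exact e3
  exact Complex.nonneg_iff.2 ⟨hre, him.symm⟩

/-- For every `b ≥ 0` there is a state attaining the norm of `b`. -/
theorem exists_state_apply_eq_norm [Nontrivial A] {b : A} (hb : 0 ≤ b) :
    ∃ f : A →L[ℂ] ℂ, ‖f‖ ≤ 1 ∧ (∀ c, 0 ≤ c → 0 ≤ f c) ∧ f b = ‖b‖ := by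
  -- Norming 1 + b instead of b forces f(1) = 1 and f(b) = ‖b‖ simultaneously.
  obtain ⟨f, hf, hfb⟩ := exists_dual_vector'' ℂ (1 + b)
  have hle : ∀ x, ‖f x‖ ≤ ‖x‖ := fun x => (f.le_opNorm x).trans <|
    mul_le_of_le_one_left (norm_nonneg x) hf
  rw [map_add, norm_one_add_of_nonneg hb] at hfb
  obtain ⟨h1, h2⟩ := Complex.eq_one_and_eq_of_add_eq (by simpa using hle 1) (hle b)
    (by simpa using hfb)
  exact ⟨f, hf, fun c hc => nonneg_of_norm_le_one_of_map_one hf h1 hc, h2⟩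

/-- A separable C⋆-algebra has a faithful positive functional. -/
theorem exists_faithful_positiveLinearMap [Nontrivial A] [TopologicalSpace.SeparableSpace A] :
    ∃ f : A →ₚ[ℂ] ℂ, ∀ a, f (star a * a) = 0 → a = 0 := by
  let u := TopologicalSpace.denseSeq A
  choose f hf hpos hfu using fun n => exists_state_apply_eq_norm (star_mul_self_nonneg (u n))
  have hle : ∀ n x, ‖f n x‖ ≤ ‖x‖ := fun n x => ((f n).le_opNorm x).trans <|
    mul_le_of_le_one_left (norm_nonneg x) (hf n)
  have hsum : ∀ x, Summable fun n : ℕ => ((1 / 2 : ℝ) ^ n : ℂ) * f n x := by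
    intro x
    refine Summable.of_norm_bounded (g := fun n : ℕ => (1 / 2 : ℝ) ^ n * ‖x‖)
      (summable_geometric_two.mul_right _) fun n => ?_
    rw [norm_mul, norm_pow, Complex.norm_real, Real.norm_of_nonneg (by norm_num)]
    gcongr
    exact hle n x
  have hcoef : ∀ n : ℕ, (0 : ℂ) < ((1 / 2 : ℝ) ^ n : ℂ) := fun n => by
    rw [← Complex.ofReal_pow]
    exact Complex.zero_lt_real.2 (by positivity)
  have hterm : ∀ x, 0 ≤ x → ∀ n : ℕ, 0 ≤ ((1 / 2 : ℝ) ^ n : ℂ) * f n x := fun x hx n =>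
    mul_nonneg (hcoef n).le (hpos n x hx)
  let F : A →ₗ[ℂ] ℂ :=
    { toFun := fun x => ∑' n : ℕ, ((1 / 2 : ℝ) ^ n : ℂ) * f n x
      map_add' := fun x y => by
        simp only [map_add, mul_add]
        exact (hsum x).tsum_add (hsum y)
      map_smul' := fun c x => by
        simp only [map_smul, smul_eq_mul, RingHom.id_apply, ← tsum_mul_left]
        exact tsum_congr fun n => by ring }
  refine ⟨PositiveLinearMap.mk₀ F fun x hx => tsum_nonneg (hterm x hx), fun a ha => ?_⟩
  have ha' : ∑' n : ℕ, ((1 / 2 : ℝ) ^ n : ℂ) * f n (star a * a) = 0 := ha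
  have hn : ∀ n, f n (star a * a) = 0 := by
    intro n
    have h0 := (hsum (star a * a)).le_tsum n fun m _ => hterm _ (star_mul_self_nonneg a) m
    rw [ha'] at h0
    have h1 := le_antisymm h0 (hterm _ (star_mul_self_nonneg a) n)
    exact (mul_eq_zero.1 h1).resolve_left (hcoef n).ne'
  -- Each `f n` kills a⋆a and norms u_n⋆u_n. By density the bound holds for every x, and x = a gives
  -- ‖a⋆a‖ ≤ 0.
  have hbound : ∀ n, ‖star (u n) * u n‖ ≤ ‖star (u n) * u n - star a * a‖ := by
    intro n
    have := hle n (star (u n) * u n - star a * a)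
    rwa [map_sub, hn, sub_zero, hfu, Complex.norm_real, norm_norm] at this
  have hall : ∀ x : A, ‖star x * x‖ ≤ ‖star x * x - star a * a‖ := by
    intro x
    refine (TopologicalSpace.denseRange_denseSeq A).induction_on x
      (isClosed_le (by fun_prop) (by fun_prop)) hbound
  have := hall a
  rw [sub_self, norm_zero, CStarRing.norm_star_mul_self] at this
  exact norm_eq_zero.1 (by nlinarith [norm_nonneg a])

end States

/-! ### Separability and a faithful separable representation. -/

open TopologicalSpace ComplexOrder in
/-- A separable C⋆-algebra has a faithful representation on a separable Hilbert space. -/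
theorem exists_faithful_separable_representation.{u} {A : Type u} [CStarAlgebra A] [Nontrivial A]
    [SeparableSpace A] :
    ∃ (E : Type u) (_ : NormedAddCommGroup E) (_ : InnerProductSpace ℂ E) (_ : CompleteSpace E)
      (_ : SeparableSpace E) (σ : A →⋆ₐ[ℂ] (E →L[ℂ] E)), Function.Injective σ := by
  let _ := CStarAlgebra.spectralOrder A
  have := CStarAlgebra.spectralOrderedRing A
  obtain ⟨f, hf⟩ := exists_faithful_positiveLinearMap (A := A)
  obtain ⟨C, hC⟩ := f.exists_norm_apply_le
  have hcont : Continuous (f.toPreGNS : A → f.PreGNS) := by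
    have hb : ∀ x, ‖f.toPreGNS x‖ ≤ Real.sqrt C * ‖x‖ := by
      intro x
      rw [PositiveLinearMap.preGNS_norm_def, Real.sqrt_le_left (by positivity), mul_pow,
        Real.sq_sqrt C.coe_nonneg, sq, ← CStarRing.norm_star_mul_self]
      exact (Complex.re_le_norm _).trans (hC _)
    exact (f.toPreGNS.toLinearMap.mkContinuous _ hb).continuous
  have : SeparableSpace f.PreGNS := f.toPreGNS.surjective.denseRange.separableSpace hcont
  refine ⟨f.GNS, inferInstance, inferInstance, inferInstance, inferInstance, f.gnsStarAlgHom, ?_⟩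
  refine (injective_iff_map_eq_zero _).2 fun a ha => hf a ?_
  -- The image of the cyclic vector under `a` has squared norm f(a⋆a).
  have h1 : f.gnsNonUnitalStarAlgHom a (f.toPreGNS 1 : f.PreGNS) = 0 := by
    have : f.gnsNonUnitalStarAlgHom a = 0 := ha
    rw [this]; rfl
  rw [PositiveLinearMap.gnsNonUnitalStarAlgHom_apply_coe, ← norm_eq_zero,
    UniformSpace.Completion.norm_coe] at h1
  have h2 := f.preGNS_norm_sq (f.leftMulMapPreGNS a (f.toPreGNS 1))
  rw [h1] at h2
  simpa using h2.symm

open TopologicalSpace in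
/-- A C⋆-algebra generated by a countable set is separable. -/
theorem separableSpace_of_topologicalClosure_adjoin_eq_top {A : Type*} [CStarAlgebra A] {G : Set A}
    (hG : G.Countable) (h : (StarAlgebra.adjoin ℂ G).topologicalClosure = ⊤) :
    SeparableSpace A := by
  have hS : (G ∪ star G).Countable := by
    refine hG.union ?_
    rw [← Set.image_star]
    exact hG.image _
  have hM : (Submonoid.closure (G ∪ star G) : Set A).Countable := by
    have := hS.to_subtype
    rw [Submonoid.closure_eq_mrange, MonoidHom.coe_mrange]
    have : Countable (FreeMonoid ↥(G ∪ star G)) := inferInstanceAs (Countable (List _))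
    exact Set.countable_range _
  have hsep : IsSeparable (closure (StarAlgebra.adjoin ℂ G : Set A)) := by
    refine IsSeparable.closure ?_
    have : (StarAlgebra.adjoin ℂ G : Set A)
        = Submodule.span ℂ (Submonoid.closure (G ∪ star G) : Set A) := by
      rw [← Algebra.adjoin_eq_span]
      rfl
    rw [this]
    exact hM.isSeparable.span
  rw [← StarSubalgebra.topologicalClosure_coe, h] at hsep
  exact isSeparable_univ_iff.1 hsep

noncomputable section

open ContinuousLinearMap

/-! ### Completely positive maps with two Kraus operators. -/

section Kraus

variable {B : Type*} [CStarAlgebra B] [PartialOrder B] [StarOrderedRing B]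

theorem CStarMatrix.map_star_mul_mul_nonneg {k : ℕ} (w : B) {M : CStarMatrix (Fin k) (Fin k) B}
    (hM : 0 ≤ M) : 0 ≤ M.map fun x => star w * x * w := by
  induction StarOrderedRing.nonneg_iff.1 hM using AddSubmonoid.closure_induction with
  | mem P hP =>
    obtain ⟨N, rfl⟩ := hP
    have : (star N * N).map (fun x => star w * x * w)
        = star (N.map fun x => x * w) * N.map fun x => x * w := by
      ext i j
      simp [CStarMatrix.mul_apply, CStarMatrix.star_apply, Finset.mul_sum, Finset.sum_mul,
        mul_assoc]
    rw [this]
    exact star_mul_self_nonneg _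
  | zero =>
    have : (0 : CStarMatrix (Fin k) (Fin k) B).map (fun x => star w * x * w) = 0 := by
      ext i j; simp
    rw [this]
  | add M N hM' hN' h₁ h₂ =>
    have : (M + N).map (fun x => star w * x * w)
        = M.map (fun x => star w * x * w) + N.map (fun x => star w * x * w) := by
      ext i j; simp [mul_add, add_mul]
    rw [this]
    exact add_nonneg (h₁ (StarOrderedRing.nonneg_iff.2 hM')) (h₂ (StarOrderedRing.nonneg_iff.2 hN'))

/-- The completely positive map `x ↦ w₁⋆ x w₁ + w₂⋆ x w₂` with two Kraus operators. -/
def CompletelyPositiveMap.kraus (w₁ w₂ : B) : B →CP B where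
  toFun x := star w₁ * x * w₁ + star w₂ * x * w₂
  map_add' x y := by simp only [mul_add, add_mul]; abel
  map_smul' c x := by simp
  map_cstarMatrix_nonneg' k M hM :=
    add_nonneg (CStarMatrix.map_star_mul_mul_nonneg w₁ hM)
      (CStarMatrix.map_star_mul_mul_nonneg w₂ hM)

theorem CompletelyPositiveMap.kraus_apply (w₁ w₂ x : B) :
    CompletelyPositiveMap.kraus w₁ w₂ x = star w₁ * x * w₁ + star w₂ * x * w₂ := rfl

end Kraus

/-! ### Hyperrigidity on separable spaces in any universe. -/

section Transport

open TopologicalSpace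

theorem Orthonormal.countable_index {E ι : Type*} [NormedAddCommGroup E] [InnerProductSpace ℂ E]
    [SeparableSpace E] {v : ι → E} (hv : Orthonormal ℂ v) : Countable ι := by
  -- The true distance is √2; the bound 1 already makes balls of radius 1/2 disjoint.
  have hdist : ∀ i j, i ≠ j → 1 ≤ dist (v i) (v j) := by
    intro i j hij
    have h := norm_sub_sq (𝕜 := ℂ) (v i) (v j)
    rw [hv.1, hv.1, hv.2 hij, ← dist_eq_norm] at h
    norm_num at h
    nlinarith [dist_nonneg (x := v i) (y := v j)]
  refine Pairwise.countable_of_isOpen_disjoint (s := fun i => Metric.ball (v i) (1 / 2)) ?_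
    (fun i => Metric.isOpen_ball) fun i => ⟨v i, Metric.mem_ball_self (by norm_num)⟩
  intro i j hij
  exact Metric.ball_disjoint_ball (by linarith [hdist i j hij])

/-- A separable Hilbert space is isometrically isomorphic to one in the lowest universe. -/
theorem exists_linearIsometryEquiv_type (E : Type*) [NormedAddCommGroup E] [InnerProductSpace ℂ E]
    [CompleteSpace E] [SeparableSpace E] :
    ∃ (F : Type) (_ : NormedAddCommGroup F) (_ : InnerProductSpace ℂ F) (_ : CompleteSpace F)
      (_ : SeparableSpace F), Nonempty (E ≃ₗᵢ[ℂ] F) := by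
  obtain ⟨w, b, -⟩ := exists_hilbertBasis ℂ E
  have := b.orthonormal.countable_index
  -- A countable index set is small, so it has a copy in the lowest universe.
  let e : Shrink.{0} w ≃ w := (equivShrink.{0} w).symm
  let b' : HilbertBasis (Shrink.{0} w) ℂ E :=
    HilbertBasis.mk (b.orthonormal.comp e e.injective) (by
      rw [Set.range_comp, e.surjective.range_eq, Set.image_univ, b.dense_span])
  have : SeparableSpace (lp (fun _ : Shrink.{0} w => ℂ) 2) :=
    b'.repr.surjective.denseRange.separableSpace b'.repr.continuous
  exact ⟨lp (fun _ : Shrink.{0} w => ℂ) 2, inferInstance, inferInstance, inferInstance, this,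
    ⟨b'.repr⟩⟩

variable {A : Type*} [CStarAlgebra A]

/-- Hyperrigidity, for a single map with two Kraus operators, on separable spaces in any
universe. -/
theorem IsHyperrigid.eq_kraus {G : Set A} (hG : IsHyperrigid G) {L : Type*} [NormedAddCommGroup L]
    [InnerProductSpace ℂ L] [CompleteSpace L] [SeparableSpace L]
    {τ : A →⋆ₐ[ℂ] (L →L[ℂ] L)} (hτ : Function.Injective τ) {w₁ w₂ : L →L[ℂ] L}
    (hw : star w₁ * w₁ + star w₂ * w₂ = 1)
    (hg : ∀ g ∈ G, star w₁ * τ g * w₁ + star w₂ * τ g * w₂ = τ g) (a : A) :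
    star w₁ * τ a * w₁ + star w₂ * τ a * w₂ = τ a := by
  obtain ⟨F, _, _, _, _, ⟨u⟩⟩ := exists_linearIsometryEquiv_type L
  let c := u.conjStarAlgEquiv
  have key : ∀ a, CompletelyPositiveMap.kraus (c w₁) (c w₂)
      ((c : (L →L[ℂ] L) →⋆ₐ[ℂ] (F →L[ℂ] F)).comp τ a)
      = c (star w₁ * τ a * w₁ + star w₂ * τ a * w₂) := fun a => by
    simp [CompletelyPositiveMap.kraus_apply, map_star]
  have h := hG.rigid F ((c : (L →L[ℂ] L) →⋆ₐ[ℂ] (F →L[ℂ] F)).comp τ)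
    (c.injective.comp hτ) (fun _ => CompletelyPositiveMap.kraus (c w₁) (c w₂))
    (fun _ => by
      rw [CompletelyPositiveMap.kraus_apply, mul_one, mul_one, ← map_star, ← map_star, ← map_mul,
        ← map_mul, ← map_add, hw, map_one])
    (fun g hgG => by
      simp only [key, hg g hgG]
      simp) a
  have h0 := tendsto_nhds_unique tendsto_const_nhds h
  rw [norm_eq_zero, sub_eq_zero, key] at h0
  exact c.injective h0

end Transport

/-! ### Hilbert sums of operators and representations. -/

section DirectSum

variable {A E F : Type*} [CStarAlgebra A]
  [NormedAddCommGroup E] [InnerProductSpace ℂ E] [CompleteSpace E]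
  [NormedAddCommGroup F] [InnerProductSpace ℂ F] [CompleteSpace F]

instance WithLp.separableSpace_prod [TopologicalSpace.SeparableSpace E]
    [TopologicalSpace.SeparableSpace F] : TopologicalSpace.SeparableSpace (WithLp 2 (E × F)) :=
  (WithLp.prodContinuousLinearEquiv 2 ℂ E F).symm.surjective.denseRange.separableSpace
    (WithLp.prodContinuousLinearEquiv 2 ℂ E F).symm.continuous

/-- The diagonal operator `S ⊕ T` on the Hilbert sum of two spaces. -/
def diagOp (S : E →L[ℂ] E) (T : F →L[ℂ] F) : WithLp 2 (E × F) →L[ℂ] WithLp 2 (E × F) :=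
  ((WithLp.prodContinuousLinearEquiv 2 ℂ E F).symm : (E × F) →L[ℂ] WithLp 2 (E × F)) ∘L
    S.prodMap T ∘L (WithLp.prodContinuousLinearEquiv 2 ℂ E F : WithLp 2 (E × F) →L[ℂ] (E × F))

omit [CompleteSpace E] [CompleteSpace F] in
@[simp]
theorem diagOp_apply (S : E →L[ℂ] E) (T : F →L[ℂ] F) (x : WithLp 2 (E × F)) :
    diagOp S T x = WithLp.toLp 2 (S x.fst, T x.snd) := rfl

theorem adjoint_diagOp (S : E →L[ℂ] E) (T : F →L[ℂ] F) :
    adjoint (diagOp S T) = diagOp (adjoint S) (adjoint T) := by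
  symm
  rw [eq_adjoint_iff]
  intro x y
  simp [WithLp.prod_inner_apply, adjoint_inner_left]

/-- The direct sum of two representations. -/
def directSumRep (π : A →⋆ₐ[ℂ] (E →L[ℂ] E)) (ρ : A →⋆ₐ[ℂ] (F →L[ℂ] F)) :
    A →⋆ₐ[ℂ] (WithLp 2 (E × F) →L[ℂ] WithLp 2 (E × F)) where
  toFun a := diagOp (π a) (ρ a)
  map_one' := by rw [map_one, map_one]; rfl
  map_mul' a b := by
    ext x
    simp
  map_zero' := by
    ext x
    simp
  map_add' a b := by rw [map_add, map_add]; rfl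
  commutes' r := by
    rw [AlgHomClass.commutes, AlgHomClass.commutes]
    rfl
  map_star' a := by
    rw [star_eq_adjoint, adjoint_diagOp, map_star, map_star, star_eq_adjoint, star_eq_adjoint]

@[simp]
theorem directSumRep_apply (π : A →⋆ₐ[ℂ] (E →L[ℂ] E)) (ρ : A →⋆ₐ[ℂ] (F →L[ℂ] F)) (a : A)
    (x : WithLp 2 (E × F)) :
    directSumRep π ρ a x = WithLp.toLp 2 (π a x.fst, ρ a x.snd) := rfl

theorem adjoint_fstL_apply (x : E) :
    adjoint (WithLp.fstL 2 ℂ E F) x = WithLp.toLp 2 (x, 0) := by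
  refine ext_inner_right ℂ fun y => ?_
  rw [adjoint_inner_left]
  simp [WithLp.prod_inner_apply]

theorem adjoint_sndL_apply (x : F) :
    adjoint (WithLp.sndL 2 ℂ E F) x = WithLp.toLp 2 (0, x) := by
  refine ext_inner_right ℂ fun y => ?_
  rw [adjoint_inner_left]
  simp [WithLp.prod_inner_apply]

end DirectSum
end

noncomputable section

open ContinuousLinearMap TopologicalSpace

/-! ### Unique extension from a hyperrigid set. -/

section UniqueExtension

variable {A H K : Type*} [CStarAlgebra A]
  [NormedAddCommGroup H] [InnerProductSpace ℂ H] [CompleteSpace H]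
  [NormedAddCommGroup K] [InnerProductSpace ℂ K] [CompleteSpace K]
  {π : A →⋆ₐ[ℂ] (H →L[ℂ] H)} {θ : A →⋆ₐ[ℂ] (K →L[ℂ] K)}

/-- If a representation agrees on a hyperrigid set with the compression of another representation
by an isometry, then they agree everywhere. -/
theorem IsHyperrigid.eq_compression [SeparableSpace H] [SeparableSpace K] {G : Set A}
    (hG : IsHyperrigid G) {V : H →L[ℂ] K} (hV : adjoint V ∘L V = 1)
    (hg : ∀ g ∈ G, π g = adjoint V ∘L θ g ∘L V) (a : A) : π a = adjoint V ∘L θ a ∘L V := by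
  cases subsingleton_or_nontrivial A with
  | inl h =>
    rw [Subsingleton.elim a 0]
    simp
  | inr h =>
    have := separableSpace_of_topologicalClosure_adjoin_eq_top hG.countable hG.generates
    obtain ⟨S, _, _, _, _, σ, hσ⟩ := exists_faithful_separable_representation (A := A)
    -- Neither π nor θ need be faithful; the summand σ makes τ so.
    let τ := directSumRep π (directSumRep θ σ)
    have hτ : Function.Injective τ := by
      intro a b hab
      refine hσ (ContinuousLinearMap.ext fun s => ?_)
      have := congrArg (fun T => (T (WithLp.toLp 2 (0, WithLp.toLp 2 (0, s)))).snd.snd) hab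
      simpa [τ] using this
    let fstH := WithLp.fstL 2 ℂ H (WithLp 2 (K × S))
    let sndH := WithLp.sndL 2 ℂ H (WithLp 2 (K × S))
    -- `w₁` carries H into the summand K by `V`, and `w₂` projects onto K ⊕ S. The Kraus map thus
    -- replaces the H-block of τ(a) by V⋆θ(a)V and keeps the rest, which fixes τ(g) for g in `G`.
    let w₁ := adjoint sndH ∘L adjoint (WithLp.fstL 2 ℂ K S) ∘L V ∘L fstH
    let w₂ := adjoint sndH ∘L sndH
    have hV' : ∀ x, adjoint V (V x) = x := fun x => DFunLike.congr_fun hV x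
    have key : ∀ (X : WithLp 2 (H × WithLp 2 (K × S)) →L[ℂ] WithLp 2 (H × WithLp 2 (K × S)))
        (x : WithLp 2 (H × WithLp 2 (K × S))), (star w₁ * X * w₁ + star w₂ * X * w₂) x
          = WithLp.toLp 2 (adjoint V (X (WithLp.toLp 2 (0, WithLp.toLp 2 (V x.fst, 0)))).snd.fst,
              (X (WithLp.toLp 2 (0, x.snd))).snd) := by
      intro X x
      have e₁ : w₁ x = WithLp.toLp 2 (0, WithLp.toLp 2 (V x.fst, 0)) := by
        simp [w₁, fstH, sndH, adjoint_fstL_apply, adjoint_sndL_apply]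
      have e₂ : ∀ y, w₂ y = WithLp.toLp 2 (0, y.snd) := fun y => by
        simp [w₂, sndH, adjoint_sndL_apply]
      have e₃ : ∀ y, adjoint w₁ y = WithLp.toLp 2 (adjoint V y.snd.fst, 0) := fun y => by
        simp [w₁, fstH, sndH, adjoint_comp, adjoint_fstL_apply]
      have e₄ : adjoint w₂ = w₂ := by rw [adjoint_comp, adjoint_adjoint]
      change adjoint w₁ (X (w₁ x)) + adjoint w₂ (X (w₂ x)) = _
      rw [e₁, e₃, e₄, e₂, e₂, ← WithLp.toLp_add, Prod.mk_add_mk, add_zero, zero_add]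
    have hone : star w₁ * w₁ + star w₂ * w₂ = 1 := by
      ext x
      have := key 1 x
      rw [mul_one, mul_one] at this
      rw [this]
      simp [hV']
      rfl
    have hgen : ∀ g ∈ G, star w₁ * τ g * w₁ + star w₂ * τ g * w₂ = τ g := by
      intro g hgG
      ext x
      rw [key]
      simp [τ, hg g hgG]
    have h := hG.eq_kraus hτ hone hgen a
    ext x
    have h' := congrArg (fun T => (T (WithLp.toLp 2 (x, 0))).fst) h
    simp only [key] at h'
    simpa [τ] using h'.symm

/-- A representation which is the compression of another one by an isometry is intertwined with
it by that isometry. -/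
theorem intertwines_of_eq_compression {V : H →L[ℂ] K} (hV : adjoint V ∘L V = 1)
    (h : ∀ a, π a = adjoint V ∘L θ a ∘L V) (a : A) (x : H) : V (π a x) = θ a (V x) := by
  have hV' : ∀ x y, inner ℂ (V x) (V y) = inner ℂ x y := fun x y => by
    rw [← adjoint_inner_left]
    exact congrArg (inner ℂ · y) (DFunLike.congr_fun hV x)
  have h1 : inner ℂ (V (π a x)) (θ a (V x)) = inner ℂ (π a x) (π a x) := by
    rw [← adjoint_inner_right V]
    exact congrArg (inner ℂ (π a x)) (DFunLike.congr_fun (h a) x).symm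
  have h2 : inner ℂ (θ a (V x)) (V (π a x)) = inner ℂ (π a x) (π a x) := by
    rw [← inner_conj_symm, h1, inner_conj_symm]
  have h3 : inner ℂ (θ a (V x)) (θ a (V x)) = inner ℂ (π a x) (π a x) := by
    have e₁ : adjoint (θ a) (θ a (V x)) = θ (star a * a) (V x) := by
      rw [map_mul, map_star]; rfl
    have e₂ : adjoint (π a) (π a x) = π (star a * a) x := by
      rw [map_mul, map_star]; rfl
    rw [← adjoint_inner_right (θ a), ← adjoint_inner_right (π a), e₁, e₂, ← adjoint_inner_right V]
    exact congrArg (inner ℂ x) (DFunLike.congr_fun (h _) x).symm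
  rw [← sub_eq_zero, ← inner_self_eq_zero (𝕜 := ℂ), inner_sub_left, inner_sub_right,
    inner_sub_right, hV', h1, h2, h3]
  simp

end UniqueExtension

/-! ### Defect operators, reducing subspaces and scalar representations. -/

section Defect

variable {H K : Type*} [NormedAddCommGroup H] [InnerProductSpace ℂ H] [CompleteSpace H]
  [NormedAddCommGroup K] [InnerProductSpace ℂ K] [CompleteSpace K]

theorem triangleOp_apply (R : H →L[ℂ] K) (x : H) : triangleOp R x = x - adjoint R (R x) := rfl

theorem isSelfAdjoint_triangleOp (R : H →L[ℂ] K) : IsSelfAdjoint (triangleOp R) := by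
  rw [isSelfAdjoint_iff', triangleOp, map_sub, adjoint_comp, adjoint_adjoint, one_def, adjoint_id]

theorem inner_triangleOp_left (R : H →L[ℂ] K) (x y : H) :
    inner ℂ (triangleOp R x) y = inner ℂ x (triangleOp R y) :=
  (isSelfAdjoint_triangleOp R).isSymmetric x y

theorem inner_map_map_eq (R : H →L[ℂ] K) (x y : H) :
    inner ℂ (R x) (R y) = inner ℂ x y - inner ℂ (triangleOp R x) y := by
  rw [triangleOp_apply, inner_sub_left, adjoint_inner_left, sub_sub_cancel]

-- Any such `D` can play the role of the positive square root: only D⋆D matters below.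
open scoped ComplexOrder in
theorem exists_adjoint_comp_eq_triangleOp {R : H →L[ℂ] K} (hR : ‖R‖ ≤ 1) :
    ∃ D : H →L[ℂ] H, adjoint D ∘L D = triangleOp R := by
  have hpos : 0 ≤ triangleOp R := by
    rw [nonneg_iff_isPositive, isPositive_def']
    refine ⟨isSelfAdjoint_triangleOp R, fun x => ?_⟩
    have h1 : ‖R x‖ ≤ ‖x‖ := (R.le_opNorm x).trans (mul_le_of_le_one_left (norm_nonneg x) hR)
    have h2 : RCLike.re (inner ℂ (R x) (R x)) ≤ RCLike.re (inner ℂ x x) := by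
      rw [inner_self_eq_norm_sq, inner_self_eq_norm_sq]
      gcongr
    rw [inner_map_map_eq, map_sub] at h2
    rw [reApplyInnerSelf]
    linarith
  obtain ⟨D, hD⟩ := CStarAlgebra.nonneg_iff_eq_star_mul_self.1 hpos
  exact ⟨D, hD.symm⟩

theorem triangleOp_adjoint_map (R : H →L[ℂ] K) (x : H) :
    triangleOp (adjoint R) (R x) = R (triangleOp R x) := by
  simp [triangleOp_apply]

theorem mem_orthogonal_range_triangleOp {R : H →L[ℂ] K} {x : H} :
    x ∈ ((triangleOp R).range.topologicalClosure)ᗮ ↔ triangleOp R x = 0 := by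
  rw [Submodule.orthogonal_closure, orthogonal_range, (isSelfAdjoint_triangleOp R).adjoint_eq]
  rfl

end Defect

section Reducing

variable {A H : Type*} [CStarAlgebra A]
  [NormedAddCommGroup H] [InnerProductSpace ℂ H] [CompleteSpace H]

theorem reduces_of_forall_mem (π : A →⋆ₐ[ℂ] (H →L[ℂ] H)) {M : Submodule ℂ H}
    (h : ∀ a, ∀ x ∈ M, π a x ∈ M) (a : A) : Reduces M (π a) :=
  ⟨h a, by rw [← star_eq_adjoint, ← map_star]; exact h (star a)⟩

theorem Reduces.orthogonal {T : H →L[ℂ] H} {M : Submodule ℂ H} (h : Reduces M T) :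
    Reduces Mᗮ T := by
  refine ⟨fun x hx y hy => ?_, fun x hx y hy => ?_⟩
  · rw [← adjoint_inner_left]
    exact hx _ (h.2 y hy)
  · rw [adjoint_inner_right]
    exact hx _ (h.1 y hy)

end Reducing

section Characters

variable {A H K : Type*} [CStarAlgebra A]
  [NormedAddCommGroup H] [InnerProductSpace ℂ H] [CompleteSpace H]
  [NormedAddCommGroup K] [InnerProductSpace ℂ K] [CompleteSpace K]

/-- The representation of `A` by the scalar operators `χ a • 1`. -/
def scalarRep (χ : A →⋆ₐ[ℂ] ℂ) (H : Type*) [NormedAddCommGroup H] [InnerProductSpace ℂ H]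
    [CompleteSpace H] : A →⋆ₐ[ℂ] (H →L[ℂ] H) where
  toFun a := χ a • 1
  map_one' := by simp
  map_mul' a b := by simp [smul_smul, mul_comm]
  map_zero' := by simp
  map_add' a b := by rw [map_add, add_smul]
  commutes' r := by simp [Algebra.algebraMap_eq_smul_one]
  map_star' a := by rw [star_smul, star_one, map_star]

theorem scalarRep_apply (χ : A →⋆ₐ[ℂ] ℂ) (a : A) (x : H) : scalarRep χ H a x = χ a • x := rfl

/-- The contraction `R` intertwines `π` and `ρ`, and `π` acts on the range of the defect operator
by the character `χ`. -/
theorem IsHyperrigid.intertwines [SeparableSpace H] [SeparableSpace K] {G : Set A}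
    (hG : IsHyperrigid G) {χ : A →⋆ₐ[ℂ] ℂ} (hχ : ∀ g ∈ G, χ g = 0)
    {π : A →⋆ₐ[ℂ] (H →L[ℂ] H)} {ρ : A →⋆ₐ[ℂ] (K →L[ℂ] K)} {R : H →L[ℂ] K} (hR : ‖R‖ ≤ 1)
    (hGR : ∀ g ∈ G, π g = adjoint R ∘L ρ g ∘L R) (a : A) (x : H) :
    R (π a x) = ρ a (R x) ∧ triangleOp R (π a x) = χ a • triangleOp R x := by
  obtain ⟨D, hD⟩ := exists_adjoint_comp_eq_triangleOp hR
  have hD' : ∀ x, adjoint D (D x) = triangleOp R x := fun x => DFunLike.congr_fun hD x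
  -- The isometric dilation x ↦ (Rx, Dx). The scalar summand χ·I contributes nothing on `G`, where χ
  -- = 0.
  let V : H →L[ℂ] WithLp 2 (K × H) :=
    adjoint (WithLp.fstL 2 ℂ K H) ∘L R + adjoint (WithLp.sndL 2 ℂ K H) ∘L D
  have hVx : ∀ x, V x = WithLp.toLp 2 (R x, D x) := fun x => by
    refine WithLp.ofLp_injective 2 (Prod.ext ?_ ?_) <;>
    simp [V, adjoint_fstL_apply, adjoint_sndL_apply]
  have hVadj : ∀ y, adjoint V y = adjoint R y.fst + adjoint D y.snd := fun y => by
    simp [V, adjoint_comp]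
  have hV : adjoint V ∘L V = 1 := by
    ext x
    simp [hVadj, hVx, hD', triangleOp_apply]
  have hcomp := hG.eq_compression (π := π) (θ := directSumRep ρ (scalarRep χ H)) hV
    fun g hg => by
      ext x
      simp [hVadj, hVx, hGR g hg, scalarRep_apply, hχ g hg]
  have h := intertwines_of_eq_compression hV hcomp a x
  rw [hVx, hVx, directSumRep_apply] at h
  refine ⟨congrArg (fun y => y.fst) h, ?_⟩
  have h2 : D (π a x) = χ a • D x := congrArg (fun y => y.snd) h
  rw [← hD', ← hD', h2, map_smul]

end Characters
end

/-! ### The isometric χ-decomposition. -/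

open ContinuousLinearMap TopologicalSpace in
theorem theorem2p7 {A H K : Type*} [CStarAlgebra A]
    [NormedAddCommGroup H] [InnerProductSpace ℂ H] [CompleteSpace H]
    [TopologicalSpace.SeparableSpace H]
    [NormedAddCommGroup K] [InnerProductSpace ℂ K] [CompleteSpace K]
    [TopologicalSpace.SeparableSpace K]
    (G : Set A) (hG : IsHyperrigid G)
    (χ : A →⋆ₐ[ℂ] ℂ) (hχ : ∀ g ∈ G, χ g = 0)
    (π : A →⋆ₐ[ℂ] (H →L[ℂ] H)) (ρ : A →⋆ₐ[ℂ] (K →L[ℂ] K))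
    (R : H →L[ℂ] K) (hR : ‖R‖ ≤ 1) (hR_not : ¬ Isometry R)
    (hGR : ∀ g ∈ G, π g = (ContinuousLinearMap.adjoint R) ∘L (ρ g) ∘L R) :
    (∀ a, Commute (triangleOp R) (π a)) ∧
    (∀ a, Commute (triangleOp (ContinuousLinearMap.adjoint R)) (ρ a)) ∧
    ∃ (R₀ : ((triangleOp R).range.topologicalClosure)ᗮ →L[ℂ]
          ((triangleOp (ContinuousLinearMap.adjoint R) ∘L R).range.topologicalClosure)ᗮ)
      (R₁ : (triangleOp R).range.topologicalClosure →L[ℂ]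
          (triangleOp (ContinuousLinearMap.adjoint R) ∘L R).range.topologicalClosure),
      IsIsometricDecomposition χ π ρ R
        ((triangleOp R).range.topologicalClosure)ᗮ
        ((triangleOp R).range.topologicalClosure)
        ((triangleOp (ContinuousLinearMap.adjoint R) ∘L R).range.topologicalClosure)ᗮ
        ((triangleOp (ContinuousLinearMap.adjoint R) ∘L R).range.topologicalClosure) R₀ R₁ ∧
      IsPureContraction R₁ ∧ DenseRange R₁ := by
  have hRπ : ∀ a x, R (π a x) = ρ a (R x) := fun a x => (hG.intertwines hχ hR hGR a x).1
  have hΔπ : ∀ a x, triangleOp R (π a x) = χ a • triangleOp R x := fun a x =>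
    (hG.intertwines hχ hR hGR a x).2
  -- The adjoint of the previous identity, taken at `star a`.
  have hπΔ : ∀ a x, π a (triangleOp R x) = χ a • triangleOp R x := fun a x => by
    refine ext_inner_right ℂ fun y => ?_
    rw [← adjoint_inner_right, ← star_eq_adjoint, ← map_star, inner_triangleOp_left, hΔπ,
      inner_smul_right, inner_smul_left, inner_triangleOp_left, map_star, starRingEnd_apply]
  have hρR : ∀ a y, adjoint R (ρ a y) = π a (adjoint R y) := fun a y => by
    refine ext_inner_right ℂ fun x => ?_
    rw [adjoint_inner_left, ← adjoint_inner_right (ρ a), ← adjoint_inner_right (π a),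
      ← star_eq_adjoint, ← star_eq_adjoint, ← map_star, ← map_star, ← hRπ, adjoint_inner_left]
  refine ⟨fun a => ?_, fun a => ?_, ?_⟩
  · ext x
    change triangleOp R (π a x) = π a (triangleOp R x)
    rw [hΔπ, hπΔ]
  · ext y
    change triangleOp (adjoint R) (ρ a y) = ρ a (triangleOp (adjoint R) y)
    rw [triangleOp_apply, triangleOp_apply, adjoint_adjoint, map_sub, hρR, hRπ]
  set Δ := triangleOp R with hΔ
  set T := triangleOp (adjoint R) ∘L R with hT
  -- This identity makes `R` map a dense part of H₁ onto a dense part of K₁, and drives both the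
  -- block form of `R` and the dense range.
  have hTR : ∀ x, T x = R (Δ x) := triangleOp_adjoint_map R
  have hH₁ : ∀ a, ∀ x ∈ Δ.range.topologicalClosure, π a x = χ a • x := fun a x hx => by
    refine Set.EqOn.closure (s := (Δ.range : Set H)) (f := π a) (g := fun x => χ a • x) ?_
      (π a).continuous (continuous_const_smul _) hx
    rintro _ ⟨y, rfl⟩
    exact hπΔ a y
  have hK₁ : ∀ a, ∀ x ∈ T.range.topologicalClosure, ρ a x = χ a • x := fun a x hx => by
    refine Set.EqOn.closure (s := (T.range : Set K)) (f := ρ a) (g := fun x => χ a • x) ?_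
      (ρ a).continuous (continuous_const_smul _) hx
    rintro _ ⟨y, rfl⟩
    change ρ a (T y) = χ a • T y
    rw [hTR, ← hRπ, hπΔ, map_smul]
  have hredH₁ := reduces_of_forall_mem π (M := Δ.range.topologicalClosure) fun a x hx => by
    rw [hH₁ a x hx]
    exact Submodule.smul_mem _ _ hx
  have hredK₁ := reduces_of_forall_mem ρ (M := T.range.topologicalClosure) fun a x hx => by
    rw [hK₁ a x hx]
    exact Submodule.smul_mem _ _ hx
  have hR₁ : ∀ x ∈ Δ.range.topologicalClosure, R x ∈ T.range.topologicalClosure := fun x hx => by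
    refine map_mem_closure R.continuous hx ?_
    rintro _ ⟨y, rfl⟩
    exact ⟨y, hTR y⟩
  have hR₀ : ∀ x ∈ (Δ.range.topologicalClosure)ᗮ, R x ∈ (T.range.topologicalClosure)ᗮ := by
    intro x hx
    rw [mem_orthogonal_range_triangleOp] at hx
    rw [Submodule.orthogonal_closure]
    rintro _ ⟨y, rfl⟩
    change inner ℂ (T y) (R x) = 0
    rw [hTR, inner_map_map_eq, inner_triangleOp_left, inner_triangleOp_left, hx, inner_zero_right,
      inner_zero_right, sub_zero]
  -- H₀ is the kernel of Δ, so `R` preserves inner products as soon as one argument lies in H₀.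
  have hiso : ∀ x ∈ (Δ.range.topologicalClosure)ᗮ, ∀ y, inner ℂ (R x) (R y) = inner ℂ x y := by
    intro x hx y
    rw [inner_map_map_eq, mem_orthogonal_range_triangleOp.1 hx, inner_zero_left, sub_zero]
  refine ⟨R.restrict hR₀, R.restrict hR₁,
    { orthogonal_left := (Submodule.isOrtho_orthogonal_right _).symm
      isCompl_left := (Submodule.isCompl_orthogonal _).symm
      orthogonal_right := (Submodule.isOrtho_orthogonal_right _).symm
      isCompl_right := (Submodule.isCompl_orthogonal _).symm
      reduces_H₀ := fun a => (hredH₁ a).orthogonal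
      reduces_H₁ := hredH₁
      reduces_K₀ := fun a => (hredK₁ a).orthogonal
      reduces_K₁ := hredK₁
      left_eq_char := fun a => by
        ext x
        exact hH₁ a x x.2
      right_eq_char := fun a => by
        ext x
        exact hK₁ a x x.2
      apply_H₀ := fun h => rfl
      apply_H₁ := fun h => rfl
      isometry := ?_
      compression := fun a => ?_ }, fun x hx => ?_, ?_⟩
  · refine AddMonoidHomClass.isometry_of_norm _ fun x => ?_
    change ‖R x‖ = ‖(x : H)‖
    rw [@norm_eq_sqrt_re_inner ℂ, @norm_eq_sqrt_re_inner ℂ, hiso x x.2]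
  · refine ContinuousLinearMap.ext fun x => ext_inner_right ℂ fun y => ?_
    rw [comp_apply, adjoint_inner_left]
    change inner ℂ (π a x) (y : H) = inner ℂ (ρ a (R x)) (R y)
    rw [← hRπ, hiso _ ((hredH₁ a).orthogonal.1 x x.2)]
  · change ‖R x‖ < ‖(x : H)‖
    refine lt_of_le_of_ne ((R.le_opNorm _).trans (mul_le_of_le_one_left (norm_nonneg _) hR))
      fun heq => hx ?_
    -- Equality of norms gives ⟨Δx, x⟩ = ‖Dx‖² = 0, hence Δx = 0. So x lies in both H₁ and its
    -- orthogonal complement.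
    obtain ⟨D, hD⟩ := exists_adjoint_comp_eq_triangleOp hR
    have hD' : ∀ x, adjoint D (D x) = Δ x := fun x => DFunLike.congr_fun hD x
    have h1 : inner ℂ (Δ x) (x : H) = 0 := by
      have h2 := inner_map_map_eq R (x : H) x
      rw [inner_self_eq_norm_sq_to_K, inner_self_eq_norm_sq_to_K, heq] at h2
      exact sub_eq_self.1 h2.symm
    rw [← hD', adjoint_inner_left, inner_self_eq_zero] at h1
    have h3 : Δ x = 0 := by rw [← hD', h1, map_zero]
    have h4 := mem_orthogonal_range_triangleOp.2 h3 x x.2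
    exact Subtype.ext (inner_self_eq_zero.1 h4)
  · intro z
    rw [Metric.mem_closure_iff]
    intro ε hε
    obtain ⟨_, ⟨y, rfl⟩, hy⟩ := Metric.mem_closure_iff.1 z.2 ε hε
    refine ⟨_, ⟨⟨Δ y, subset_closure ⟨y, rfl⟩⟩, rfl⟩, ?_⟩
    change dist (z : K) (R (Δ y)) < ε
    rw [← hTR]
    exact hy
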